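/- Let $p$ be a prime. A group is residually $p$ if the intersection of its normal subgroups of $p$-power index is trivial, and virtually residually $p$ if it has a finite index subgroup which is residually $p$. A graph $Y$ (in the sense of Serre) consists of a vertex set $V$, an edge set $E$, maps $o,t\colon E\to V$ and a map $e\mapsto\overline{e}$ on $E$ with $\overline{\overline{e}}=e$, $\overline{e}\neq e$ and $o(e)=t(\overline{e})$ for all $e\in E$. A graph of groups $\mathcal{G}$ based on $Y$ consists of groups $G_v$ ($v\in V$) and $G_e=G_{\overline{e}}$ ($e\in E$) and injective group morphisms $f_e\colon G_e\to G_{t(e)}$ ($e\in E$). Its path group $\pi(\mathcal{G})$ is generated by the groups $G_v$ ($v \in V$) and the elements $e\in E$, subject to the relations $e\,f_e(g)\,\overline{e}=f_{\overline{e}}(g)$ ($e\in E$, $g\in G_e$). For a vertex $v_0$, the fundamental group $\pi_1(\mathcal{G},v_0)$ is the subgroup of $\pi(\mathcal{G})$ consisting of all elements $g_0e_1g_1\cdots e_ng_n$ ($n\geq 0$), where $(e_1,\dots,e_n)$ is a path in $Y$ from $v_0$ to $v_0$, $g_0\in G_{v_0}$, and $g_i\in G_{t(e_i)}$ for $i=1,\dots,n$.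 (1) Let $\mathcal{G}$ be a graph of groups based on a finite connected graph $Y$, such that every vertex group $G_v$ is finitely generated and virtually residually $p$, and such that $f_e\colon G_e\to G_{t(e)}$ is bijective for every edge $e$ of $Y$. Then for every vertex $v_0$ of $Y$ the group $\pi_1(\mathcal{G},v_0)$ is virtually residually $p$. (2) Let $G$ be a finitely generated virtually residually $p$ group, $r\geq 0$, and let $\varphi_1,\dots,\varphi_r$ be automorphisms of $G$. Then their mapping torus $$\langle G, t_1,\dots,t_r : t_i g t_i^{-1}=\varphi_i(g),\ i=1,\dots,r,\ g\in G\rangle$$ is virtually residually $p$. -/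

import Mathlib

/-- A group is residually `p` if the intersection of its normal subgroups of `p`-power index is
trivial: every `g ≠ 1` is missed by some normal subgroup of index a power of `p`. -/
def ResiduallyP (p : ℕ) (G : Type*) [Group G] : Prop :=
  ∀ g : G, g ≠ 1 → ∃ N : Subgroup G, N.Normal ∧ (∃ k : ℕ, N.index = p ^ k) ∧ g ∉ N

/-- A group is virtually residually `p` if it has a finite index subgroup that is residually `p`. -/
def VirtuallyResiduallyP (p : ℕ) (G : Type*) [Group G] : Prop :=
  ∃ H : Subgroup G, H.FiniteIndex ∧ ResiduallyP p H

/-- A graph in the sense of Serre, with vertex set `V` and edge set `E`: every edge `e` has an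
origin `o e`, a terminus `t e`, and an inverse edge `bar e ≠ e`. -/
structure SerreGraph (V E : Type*) where
  o : E → V
  t : E → V
  bar : E → E
  bar_bar : ∀ e, bar (bar e) = e
  bar_ne : ∀ e, bar e ≠ e
  o_eq_t_bar : ∀ e, o e = t (bar e)

namespace SerreGraph

variable {V E : Type*} (Y : SerreGraph V E)

/-- Any two vertices are joined by a path of edges. -/
def Connected : Prop :=
  ∀ v w : V, Relation.ReflTransGen (fun a b => ∃ e : E, Y.o e = a ∧ Y.t e = b) v w

/-- The set of topological edges `{e, bar e}`. -/
def TopEdge : Type _ := Quot (fun e e' : E => e' = Y.bar e)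

/-- The topological edge `{e, bar e}` of an edge `e`. -/
def topEdge (e : E) : Y.TopEdge := Quot.mk _ e

theorem topEdge_bar (e : E) : Y.topEdge e = Y.topEdge (Y.bar e) := Quot.sound rfl

theorem t_bar (e : E) : Y.t (Y.bar e) = Y.o e := (Y.o_eq_t_bar e).symm

theorem o_bar (e : E) : Y.o (Y.bar e) = Y.t e := by rw [Y.o_eq_t_bar, Y.bar_bar]

end SerreGraph

/-- A graph of groups based on `Y`: vertex groups `G_v`, edge groups `G_e` with `G_e = G_{bar e}`
(that is, a family of groups indexed by the topological edges), and for each edge `e` an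
embedding `f_e : G_e → G_{t e}`. -/
structure GraphOfGroups {V : Type*} {E : Type*} (Y : SerreGraph V E) where
  vertexGroup : V → Type*
  edgeGroup : Y.TopEdge → Type*
  [instVertex : ∀ v, Group (vertexGroup v)]
  [instEdge : ∀ a, Group (edgeGroup a)]
  edgeMap : ∀ e : E, edgeGroup (Y.topEdge e) →* vertexGroup (Y.t e)
  edgeMap_injective : ∀ e, Function.Injective (edgeMap e)

namespace GraphOfGroups

attribute [instance] instVertex instEdge

variable {V E : Type*} {Y : SerreGraph V E} (𝒢 : GraphOfGroups Y)

/-- The identity `G_a = G_b` for equal topological edges `a = b`. -/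
def edgeCast {a b : Y.TopEdge} (h : a = b) : 𝒢.edgeGroup a ≃* 𝒢.edgeGroup b :=
  h ▸ MulEquiv.refl _

/-- The map `f_{bar e}`, on `G_e = G_{bar e}`. -/
def edgeMapBar (e : E) : 𝒢.edgeGroup (Y.topEdge e) →* 𝒢.vertexGroup (Y.t (Y.bar e)) :=
  (𝒢.edgeMap (Y.bar e)).comp (𝒢.edgeCast (Y.topEdge_bar e)).toMonoidHom

/-- The free product of all vertex groups and the free group on the set of edges. -/
abbrev PrePathGroup : Type _ :=
  Monoid.Coprod (Monoid.CoprodI 𝒢.vertexGroup) (FreeGroup E)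

/-- An element of a vertex group, as a generator. -/
def preVertex (v : V) : 𝒢.vertexGroup v →* 𝒢.PrePathGroup :=
  Monoid.Coprod.inl.comp Monoid.CoprodI.of

/-- An edge, as a generator. -/
def preEdge (e : E) : 𝒢.PrePathGroup := Monoid.Coprod.inr (FreeGroup.of e)

/-- The relators of the relations `e f_e(g) (bar e) = f_{bar e}(g)`. -/
def pathRelators : Set 𝒢.PrePathGroup :=
  {x | ∃ (e : E) (g : 𝒢.edgeGroup (Y.topEdge e)),
    x = 𝒢.preEdge e * 𝒢.preVertex _ (𝒢.edgeMap e g) * 𝒢.preEdge (Y.bar e) *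
      (𝒢.preVertex _ (𝒢.edgeMapBar e g))⁻¹}

/-- The path group `π(𝒢)`: generated by the vertex groups and the edges, subject to the relations
`e f_e(g) (bar e) = f_{bar e}(g)`. -/
abbrev PathGroup : Type _ := 𝒢.PrePathGroup ⧸ Subgroup.normalClosure 𝒢.pathRelators

/-- The natural morphism from a vertex group to the path group. -/
def ofVertex (v : V) : 𝒢.vertexGroup v →* 𝒢.PathGroup :=
  (QuotientGroup.mk' _).comp (𝒢.preVertex v)

/-- The element of the path group given by an edge. -/
def ofEdge (e : E) : 𝒢.PathGroup := QuotientGroup.mk' _ (𝒢.preEdge e)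

/-- `𝒢.Represented v w x`: the element `x` of `π(𝒢)` is represented by a path in `𝒢` from `v` to
`w`, that is, `x = g₀ e₁ g₁ ⋯ eₙ gₙ` where `(e₁, …, eₙ)` is a path of length `n ≥ 0` in `Y` from
`v` to `w`, `g₀ ∈ G_v`, and `gᵢ ∈ G_{t(eᵢ)}` for `i ≥ 1`. -/
inductive Represented (v : V) : V → 𝒢.PathGroup → Prop
  | start (g : 𝒢.vertexGroup v) : Represented v v (𝒢.ofVertex v g)
  | step (e : E) (g : 𝒢.vertexGroup (Y.t e)) {x : 𝒢.PathGroup} (h : Represented v (Y.o e) x) :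
      Represented v (Y.t e) (x * 𝒢.ofEdge e * 𝒢.ofVertex (Y.t e) g)

theorem ofEdge_mul_ofEdge_bar (e : E) : 𝒢.ofEdge e * 𝒢.ofEdge (Y.bar e) = 1 := by
  have h : 𝒢.preEdge e * 𝒢.preEdge (Y.bar e) ∈ Subgroup.normalClosure 𝒢.pathRelators :=
    Subgroup.subset_normalClosure ⟨e, 1, by simp⟩
  simpa [ofEdge] using (QuotientGroup.eq_one_iff _).2 h

theorem inv_ofEdge (e : E) : (𝒢.ofEdge e)⁻¹ = 𝒢.ofEdge (Y.bar e) :=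
  inv_eq_of_mul_eq_one_right (𝒢.ofEdge_mul_ofEdge_bar e)

theorem Represented.mul_ofVertex {v w : V} {x : 𝒢.PathGroup} (hx : 𝒢.Represented v w x)
    (g : 𝒢.vertexGroup w) : 𝒢.Represented v w (x * 𝒢.ofVertex w g) := by
  cases hx with
  | start g₀ => rw [← map_mul]; exact .start _
  | step e g₀ h => rw [mul_assoc, ← map_mul]; exact .step e _ h

theorem Represented.mul {u v w : V} {x y : 𝒢.PathGroup} (hx : 𝒢.Represented u v x)
    (hy : 𝒢.Represented v w y) : 𝒢.Represented u w (x * y) := by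
  induction hy with
  | start g => exact hx.mul_ofVertex 𝒢 g
  | step e g _ ih => rw [← mul_assoc, ← mul_assoc]; exact .step e g ih

theorem Represented.ofEdge' {u v : V} (e : E) (hu : Y.o e = u) (hv : Y.t e = v) :
    𝒢.Represented u v (𝒢.ofEdge e) := by
  subst hu hv
  simpa using Represented.step e 1 (Represented.start (𝒢 := 𝒢) (v := Y.o e) 1)

theorem Represented.inv {v w : V} {x : 𝒢.PathGroup} (hx : 𝒢.Represented v w x) :
    𝒢.Represented w v x⁻¹ := by
  induction hx with
  | start g => rw [← map_inv]; exact .start _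
  | step e g _ ih =>
    rw [mul_inv_rev, mul_inv_rev, ← map_inv, inv_ofEdge]
    exact (Represented.start _).mul 𝒢
      ((Represented.ofEdge' 𝒢 (Y.bar e) (Y.o_bar e) (Y.t_bar e)).mul 𝒢 ih)

/-- The fundamental group `π₁(𝒢, v₀)`: the subgroup of the path group consisting of the elements
represented by paths in `𝒢` from `v₀` back to itself. -/
def fundamentalGroup (v₀ : V) : Subgroup 𝒢.PathGroup where
  carrier := {x | 𝒢.Represented v₀ v₀ x}
  mul_mem' hx hy := Represented.mul 𝒢 hx hy
  one_mem' := by simpa using Represented.start (𝒢 := 𝒢) (v := v₀) 1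
  inv_mem' hx := Represented.inv 𝒢 hx

end GraphOfGroups

/-- The relators of the relations `tᵢ g tᵢ⁻¹ = φᵢ(g)`, in the free product of `G` and the free
group on the letters `tᵢ`. -/
def mappingTorusRelators {G ι : Type*} [Group G] (φ : ι → G →* G) :
    Set (Monoid.Coprod G (FreeGroup ι)) :=
  {x | ∃ (i : ι) (g : G),
    x = Monoid.Coprod.inr (FreeGroup.of i) * Monoid.Coprod.inl g *
      (Monoid.Coprod.inr (FreeGroup.of i))⁻¹ * (Monoid.Coprod.inl (φ i g))⁻¹}

/-- The mapping torus `⟨G, tᵢ (i ∈ ι) : tᵢ g tᵢ⁻¹ = φᵢ(g), i ∈ ι, g ∈ G⟩` of a family of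
endomorphisms `φᵢ` of a group `G`. -/
abbrev MappingTorus {G ι : Type*} [Group G] (φ : ι → G →* G) : Type _ :=
  Monoid.Coprod G (FreeGroup ι) ⧸ Subgroup.normalClosure (mappingTorusRelators φ)

/-!
Both groups embed in a semidirect product `G ⋊ F` with `G` finitely generated and virtually
residually `p` and `F` free, so it suffices to treat these: virtual residual `p`-ness passes to
subgroups.

For the mapping torus the embedding is the obvious one, with `F` free on the letters `tᵢ`
(`MappingTorus.toSemidirect_injective`). For a graph of groups whose edge maps are all bijective,
connectedness allows one to identify all vertex groups with `G = G_{v₀}`; an edge `e` then acts on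
`G` by an automorphism, with `bar e` acting by its inverse, and this defines a morphism from the
path group to `G ⋊ F`, where `F` is free on the edges and only one generator from each pair
`{e, bar e}` is used (`GraphOfGroups.orientedEdge`). In the path group vertex elements can
be moved to the left past edges, so an element of `π₁(𝒢, v₀)` is a product of an element of
`G_{v₀}` and a word in the edges; both can be read off in `G ⋊ F`, whence injectivity
(`GraphOfGroups.toSemidirect_comp_subtype_injective`).

For `G ⋊ F` (`VirtuallyResiduallyP.semidirectProduct`), one first replaces `G` by a residually `p`
characteristic subgroup `K` of finite index, which exists as `G` has finitely many subgroups of a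
given index. The intersection `L` of the subgroups of index `p` of `K` is characteristic of finite
index, so a finite index subgroup `F'` of `F` acts trivially on `K / L`. Then `K ⋊ F'` is residually
`p` (`ResiduallyP.semidirectProduct`): elements outside `K` are detected in `F'`, since free groups
are residually `p` (`residuallyP_freeGroup`, by unitriangular representations over `ℤ / p ^ m`); an
element of `K` is detected in a characteristic quotient `P` of `K` of `p`-power order, on which `F'`
acts through a `p`-group `Q` by a theorem of P. Hall (`IsPGroup.of_forall_mem_of_index_eq`), so that
it survives in the finite `p`-group `P ⋊ Q`.
-/

/-! ### Residually `p` and virtually residually `p` groups -/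

theorem MonoidHom.exists_index_ker_eq_prime_pow {p : ℕ} (hp : p.Prime) {G P : Type*} [Group G]
    [Group P] (f : G →* P) [Finite f.range] (hf : IsPGroup p f.range) :
    ∃ k : ℕ, f.ker.index = p ^ k := by
  have := Fact.mk hp
  obtain ⟨k, hk⟩ := IsPGroup.iff_card.1 hf
  exact ⟨k, by rw [Subgroup.index_ker, hk]⟩

theorem Subgroup.exists_index_comap_eq_prime_pow {p : ℕ} (hp : p.Prime) {A B : Type*} [Group A]
    [Group B] (f : A →* B) (N : Subgroup B) [N.Normal] {k : ℕ} (hk : N.index = p ^ k) :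
    ∃ l : ℕ, (N.comap f).index = p ^ l := by
  have h : (N.comap f).index ∣ p ^ k := by
    rw [Subgroup.index_comap, ← hk]
    exact Subgroup.relIndex_dvd_index_of_normal _ _
  obtain ⟨l, -, hl⟩ := (Nat.dvd_prime_pow hp).1 h
  exact ⟨l, hl⟩

theorem ResiduallyP.of_injective {p : ℕ} (hp : p.Prime) {A B : Type*} [Group A] [Group B]
    (hB : ResiduallyP p B) (f : A →* B) (hf : Function.Injective f) : ResiduallyP p A := by
  intro a ha
  obtain ⟨N, hN, ⟨k, hk⟩, haN⟩ := hB (f a) fun h => ha (hf (h.trans (map_one f).symm))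
  exact ⟨N.comap f, inferInstance, Subgroup.exists_index_comap_eq_prime_pow hp f N hk, haN⟩

theorem VirtuallyResiduallyP.of_injective {p : ℕ} (hp : p.Prime) {A B : Type*} [Group A] [Group B]
    (hB : VirtuallyResiduallyP p B) (f : A →* B) (hf : Function.Injective f) :
    VirtuallyResiduallyP p A := by
  obtain ⟨H, hH, hr⟩ := hB
  refine ⟨H.comap f, ⟨?_⟩, hr.of_injective hp (f.subgroupComap H) fun a b hab => ?_⟩
  · rw [Subgroup.index_comap]
    exact mt Subgroup.index_eq_zero_of_relIndex_eq_zero hH.index_ne_zero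
  · exact Subtype.ext (hf (congrArg Subtype.val hab))

/-! ### Subgroups of bounded index in finitely generated groups -/

theorem Group.FG.finite_monoidHom {G Q : Type*} [Group G] [Group.FG G] [Group Q] [Finite Q] :
    Finite (G →* Q) := by
  obtain ⟨S, hS⟩ := Group.FG.out (G := G)
  refine Finite.of_injective (fun (f : G →* Q) (s : S) => f s) fun f g h => ?_
  exact MonoidHom.eq_of_eqOn_dense hS fun s hs => congrFun h ⟨s, hs⟩

/-- A finitely generated group has finitely many subgroups of a given finite index: each of them is
a point stabilizer of a permutation action on its cosets. -/
theorem Group.FG.finite_setOf_index_eq {G : Type*} [Group G] [Group.FG G] {n : ℕ} (hn : n ≠ 0) :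
    {H : Subgroup G | H.index = n}.Finite := by
  have : Finite (G →* Equiv.Perm (Fin n)) := Group.FG.finite_monoidHom
  let S : (G →* Equiv.Perm (Fin n)) × Fin n → Subgroup G := fun x =>
    (MulAction.stabilizer (Equiv.Perm (Fin n)) x.2).comap x.1
  refine (Set.finite_range S).subset fun H hH => ?_
  have hH : H.index = n := hH
  have : H.FiniteIndex := ⟨hH ▸ hn⟩
  let e : G ⧸ H ≃ Fin n := Finite.equivFinOfCardEq hH
  refine ⟨((e.permCongrHom : Equiv.Perm (G ⧸ H) ≃* _).toMonoidHom.comp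
    (MulAction.toPermHom G (G ⧸ H)), e (1 : G)), ?_⟩
  ext g
  simp [S, MulAction.mem_stabilizer_iff, Equiv.permCongrHom, Equiv.permCongr_apply]
  rw [eq_comm, QuotientGroup.eq]
  simp

/-- The intersection of all subgroups of index `n`. -/
def Subgroup.iInfIndexEq (G : Type*) [Group G] (n : ℕ) : Subgroup G :=
  ⨅ H : {H : Subgroup G // H.index = n}, (H : Subgroup G)

theorem Subgroup.mem_iInfIndexEq {G : Type*} [Group G] {n : ℕ} {g : G} :
    g ∈ Subgroup.iInfIndexEq G n ↔ ∀ H : Subgroup G, H.index = n → g ∈ H := by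
  simp [Subgroup.iInfIndexEq, Subgroup.mem_iInf]

instance Subgroup.iInfIndexEq_characteristic (G : Type*) [Group G] (n : ℕ) :
    (Subgroup.iInfIndexEq G n).Characteristic := by
  refine Subgroup.characteristic_iff_le_comap.2 fun e g hg => ?_
  rw [Subgroup.mem_comap, Subgroup.mem_iInfIndexEq]
  intro H hH
  refine Subgroup.mem_iInfIndexEq.1 hg (H.comap e.toMonoidHom) ?_
  rw [Subgroup.index_comap_of_surjective H e.surjective, hH]

theorem Subgroup.iInfIndexEq_finiteIndex (G : Type*) [Group G] [Group.FG G] {n : ℕ} (hn : n ≠ 0) :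
    (Subgroup.iInfIndexEq G n).FiniteIndex := by
  have : Finite {H : Subgroup G // H.index = n} := (Group.FG.finite_setOf_index_eq hn).to_subtype
  exact Subgroup.finiteIndex_iInf fun H => ⟨H.2.trans_ne hn⟩

theorem Subgroup.exists_index_iInf_eq_prime_pow {p : ℕ} (hp : p.Prime) {G ι : Type*} [Group G]
    [Finite ι] (N : ι → Subgroup G) (hN : ∀ i, (N i).Normal)
    (h : ∀ i, ∃ k : ℕ, (N i).index = p ^ k) : ∃ k : ℕ, (⨅ i, N i).index = p ^ k := by
  have := Fact.mk hp
  have hfin (i) : Finite (G ⧸ N i) := by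
    obtain ⟨k, hk⟩ := h i
    have : (N i).FiniteIndex := ⟨hk ▸ pow_ne_zero _ hp.ne_zero⟩
    infer_instance
  let f : G →* ∀ i, G ⧸ N i := MonoidHom.pi fun i => QuotientGroup.mk' (N i)
  have hker : f.ker = ⨅ i, N i := by
    ext g
    simp [f, MonoidHom.mem_ker, Subgroup.mem_iInf, funext_iff]
  rw [← hker]
  refine f.exists_index_ker_eq_prime_pow hp (IsPGroup.to_subgroup (IsPGroup.iff_card.2 ?_) _)
  choose k hk using h
  have := Fintype.ofFinite ι
  exact ⟨∑ i, k i, by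
    rw [Nat.card_pi, ← Finset.prod_pow_eq_pow_sum]; exact Finset.prod_congr rfl fun i _ => hk i⟩

/-- In a finitely generated group a normal subgroup of `p`-power index contains a characteristic
one: the intersection of all normal subgroups of the same index. -/
theorem Subgroup.exists_characteristic_le_of_index_eq_prime_pow {p : ℕ} (hp : p.Prime) {G : Type*}
    [Group G] [Group.FG G] (N : Subgroup G) [hN : N.Normal] {k : ℕ} (hk : N.index = p ^ k) :
    ∃ M : Subgroup G, M.Characteristic ∧ M ≤ N ∧ ∃ l : ℕ, M.index = p ^ l := by
  let S := {H : Subgroup G // H.Normal ∧ H.index = p ^ k}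
  have : Finite S := ((Group.FG.finite_setOf_index_eq (pow_ne_zero k hp.ne_zero)).subset
    fun H (hH : H.Normal ∧ H.index = p ^ k) => hH.2).to_subtype
  refine ⟨⨅ H : S, H.1, ?_, iInf_le (fun H : S => H.1) ⟨N, hN, hk⟩,
    Subgroup.exists_index_iInf_eq_prime_pow hp _ (fun H => H.2.1) fun H => ⟨k, H.2.2⟩⟩
  refine Subgroup.characteristic_iff_le_comap.2 fun e g hg => ?_
  rw [Subgroup.mem_comap, Subgroup.mem_iInf]
  rintro ⟨H, hH, hi⟩
  refine Subgroup.mem_iInf.1 hg ⟨H.comap e.toMonoidHom, hH.comap _, ?_⟩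
  rw [Subgroup.index_comap_of_surjective H e.surjective, hi]

/-! ### Automorphism groups of finite `p`-groups -/

/-- An automorphism of prime order `q ≠ p` of a finite `p`-group fixes a point in every left coset
it preserves, as the size of the coset is prime to `q`. -/
theorem MulAut.exists_mem_coset_fixed {p q : ℕ} [Fact p.Prime] [Fact q.Prime] (hqp : q ≠ p)
    {P : Type*} [Group P] [Finite P] (hP : IsPGroup p P) (a : MulAut P) (ha : a ^ q = 1)
    (M : Subgroup P) (hM : ∀ g, g⁻¹ * a g ∈ M) (x : P) : ∃ m ∈ M, a (x * m) = x * m := by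
  classical
  let T := {y : P // x⁻¹ * y ∈ M}
  have hT (y : P) : x⁻¹ * y ∈ M ↔ x⁻¹ * a y ∈ M := by
    rw [show x⁻¹ * a y = x⁻¹ * y * (y⁻¹ * a y) by group]
    exact (M.mul_mem_cancel_right (hM y)).symm
  let σ : Equiv.Perm T := (MulAut.toPerm P a).subtypePerm fun y => (hT y).symm
  have hσ : σ ^ q ^ 1 = 1 := by
    ext y
    have h : ∀ n : ℕ, (((σ ^ n) y : T) : P) = (a ^ n) y := by
      intro n
      induction n with
      | zero => rfl
      | succ n ih =>
        rw [pow_succ', pow_succ', Equiv.Perm.mul_apply, MulAut.mul_apply, ← ih]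
        rfl
    rw [pow_one, h, ha]
    rfl
  have := Fintype.ofFinite T
  have hcard : ¬ q ∣ Fintype.card T := by
    let e : T ≃ M := ⟨fun y => ⟨_, y.2⟩, fun m => ⟨x * m, by simp⟩,
      fun y => Subtype.ext (by simp), fun m => Subtype.ext (by simp)⟩
    obtain ⟨k, hk⟩ := IsPGroup.iff_card.1 (hP.to_subgroup M)
    rw [← Nat.card_eq_fintype_card, Nat.card_congr e, hk]
    intro h
    exact hqp ((Nat.prime_dvd_prime_iff_eq Fact.out Fact.out).1 (Nat.Prime.dvd_of_dvd_pow Fact.out h))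
  obtain ⟨⟨y, hy⟩, hfix⟩ := Equiv.Perm.exists_fixed_point_of_prime hcard hσ
  exact ⟨x⁻¹ * y, hy, by
    rw [mul_inv_cancel_left]; exact congrArg Subtype.val hfix⟩

/-- Automorphisms of a finite `p`-group which preserve every coset of every subgroup of index `p`
form a `p`-group (P. Hall). The fixed points of an automorphism of prime order `q ≠ p` meet every
coset of a maximal subgroup, so that they lie in none. -/
theorem IsPGroup.of_forall_mem_of_index_eq {p : ℕ} [Fact p.Prime] {P : Type*} [Group P] [Finite P]
    (hP : IsPGroup p P) (A : Subgroup (MulAut P))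
    (hA : ∀ a ∈ A, ∀ M : Subgroup P, M.index = p → ∀ g, g⁻¹ * a g ∈ M) : IsPGroup p A := by
  have hp : p.Prime := Fact.out
  rw [isPGroup_iff_primeFactors_card_subset hp.ne_zero]
  intro q hq
  rw [hp.primeFactors, Finset.mem_singleton]
  by_contra hqp
  have := Fact.mk (Nat.prime_of_mem_primeFactors hq)
  obtain ⟨⟨a, haA⟩, ha⟩ := exists_prime_orderOf_dvd_card' q (Nat.dvd_of_mem_primeFactors hq)
  have haq : a ^ q = 1 := by
    have := pow_orderOf_eq_one (⟨a, haA⟩ : A)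
    rw [ha] at this
    exact congrArg Subtype.val this
  let S : Subgroup P := a.toMonoidHom.eqLocus (MonoidHom.id P)
  have hS : S ≠ ⊤ := by
    intro h
    have h1 : a = 1 := by
      ext x
      exact (h ▸ Subgroup.mem_top x : x ∈ S)
    have : (⟨a, haA⟩ : A) = 1 := Subtype.ext h1
    rw [this, orderOf_one] at ha
    exact (Nat.prime_of_mem_primeFactors hq).one_lt.ne ha
  obtain ⟨n, hn⟩ := IsPGroup.iff_card.1 hP
  obtain ⟨m, hm⟩ := IsPGroup.iff_card.1 (hP.to_subgroup S)
  have hmn : m < n := by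
    have hle : Nat.card S < Nat.card P :=
      lt_of_le_of_ne (Subgroup.card_le_card_group S) fun h => hS (Subgroup.eq_top_of_card_eq S h)
    rwa [hn, hm, Nat.pow_lt_pow_iff_right hp.one_lt] at hle
  obtain ⟨n, rfl⟩ : ∃ k, n = k + 1 := ⟨n - 1, by omega⟩
  obtain ⟨M, hM, hSM⟩ := Sylow.exists_subgroup_card_pow_prime_le p
    (hn ▸ pow_dvd_pow p (Nat.le_succ n)) S hm (Nat.lt_succ_iff.1 hmn)
  have hMi : M.index = p := by
    have := M.card_mul_index
    rw [hM, hn, pow_succ] at this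
    exact Nat.eq_of_mul_eq_mul_left (pow_pos hp.pos n) this
  have htop : M = ⊤ := by
    refine (Subgroup.eq_top_iff' M).2 fun x => ?_
    obtain ⟨m, hm, hfix⟩ := MulAut.exists_mem_coset_fixed hqp hP a haq M (hA a haA M hMi) x
    exact (M.mul_mem_cancel_right hm).1 (hSM hfix)
  rw [htop, Subgroup.index_top] at hMi
  exact hp.one_lt.ne hMi

/-! ### Semidirect products -/

/-- The action of automorphisms on the quotient by a characteristic subgroup. -/
def MulAut.quotientCharacteristic {G : Type*} [Group G] (M : Subgroup G) [M.Characteristic] :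
    MulAut G →* MulAut (G ⧸ M) where
  toFun a := QuotientGroup.congr M M a (Subgroup.characteristic_iff_map_eq.1 inferInstance a)
  map_one' := by
    ext x
    obtain ⟨g, rfl⟩ := QuotientGroup.mk_surjective x
    rfl
  map_mul' a b := by
    ext x
    obtain ⟨g, rfl⟩ := QuotientGroup.mk_surjective x
    rfl

theorem MulAut.quotientCharacteristic_mk {G : Type*} [Group G] (M : Subgroup G) [M.Characteristic]
    (a : MulAut G) (g : G) :
    MulAut.quotientCharacteristic M a (g : G ⧸ M) = ((a g : G) : G ⧸ M) := rfl

/-- If `F` preserves the cosets of the subgroups of index `p` of `G`, then it acts on every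
characteristic quotient of `p`-power order through a `p`-group. -/
theorem ResiduallyP.semidirectProduct {p : ℕ} (hp : p.Prime) {G F : Type*} [Group G] [Group F]
    [Group.FG G] (hG : ResiduallyP p G) (hF : ResiduallyP p F) (ψ : F →* MulAut G)
    (hψ : ∀ (w : F) (M : Subgroup G), M.index = p → ∀ g, g⁻¹ * ψ w g ∈ M) :
    ResiduallyP p (G ⋊[ψ] F) := by
  have := Fact.mk hp
  intro x hx
  by_cases hr : x.right = 1
  · obtain ⟨N, hN, ⟨k, hk⟩, hxN⟩ := hG x.left fun h => hx (SemidirectProduct.ext h hr)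
    obtain ⟨M, hM, hMN, l, hl⟩ := N.exists_characteristic_le_of_index_eq_prime_pow hp hk
    have : M.FiniteIndex := ⟨hl ▸ pow_ne_zero _ hp.ne_zero⟩
    have hP : IsPGroup p (G ⧸ M) := IsPGroup.of_card (n := l) hl
    let ρ : F →* MulAut (G ⧸ M) := (MulAut.quotientCharacteristic M).comp ψ
    have hρ : IsPGroup p ρ.range := by
      refine hP.of_forall_mem_of_index_eq _ ?_
      rintro _ ⟨w, rfl⟩ L hL y
      obtain ⟨g, rfl⟩ := QuotientGroup.mk_surjective y
      refine hψ w (L.comap (QuotientGroup.mk' M)) ?_ g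
      rw [Subgroup.index_comap_of_surjective L (QuotientGroup.mk'_surjective M), hL]
    let f : G ⋊[ψ] F →* (G ⧸ M) ⋊[ρ.range.subtype] ρ.range :=
      SemidirectProduct.map (QuotientGroup.mk' M) ρ.rangeRestrict fun w => rfl
    have : Finite ((G ⧸ M) ⋊[ρ.range.subtype] ρ.range) :=
      Finite.of_equiv _ SemidirectProduct.equivProd.symm
    obtain ⟨m, hm⟩ := IsPGroup.iff_card.1 hρ
    have hT : IsPGroup p ((G ⧸ M) ⋊[ρ.range.subtype] ρ.range) := by
      refine IsPGroup.of_card (n := l + m) ?_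
      rw [SemidirectProduct.card, hm, pow_add]
      exact congrArg (· * p ^ m) hl
    refine ⟨f.ker, inferInstance, f.exists_index_ker_eq_prime_pow hp (hT.to_subgroup _), ?_⟩
    intro h
    have h1 : ((x.left : G) : G ⧸ M) = 1 := congrArg SemidirectProduct.left h
    exact hxN (hMN ((QuotientGroup.eq_one_iff _).1 h1))
  · obtain ⟨N, hN, ⟨k, hk⟩, hxN⟩ := hF x.right hr
    exact ⟨N.comap SemidirectProduct.rightHom, inferInstance,
      Subgroup.exists_index_comap_eq_prime_pow hp _ N hk, hxN⟩

/-- An extension of a residually `p` group by a finitely generated virtually residually `p` group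
is virtually residually `p` when it splits: after passing to a characteristic residually `p`
subgroup `K` of finite index in `G`, a finite index subgroup of `F` acts trivially on the finite
quotient of `K` by the intersection of the subgroups of index `p`. -/
theorem VirtuallyResiduallyP.semidirectProduct {p : ℕ} (hp : p.Prime) {G F : Type*} [Group G]
    [Group F] [Group.FG G] (hG : VirtuallyResiduallyP p G) (hF : ResiduallyP p F)
    (ψ : F →* MulAut G) : VirtuallyResiduallyP p (G ⋊[ψ] F) := by
  obtain ⟨H, hH, hr⟩ := hG
  let K : Subgroup G := Subgroup.iInfIndexEq G H.index
  have hKH : K ≤ H := fun g hg => Subgroup.mem_iInfIndexEq.1 hg H rfl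
  have hKfin : K.FiniteIndex := Subgroup.iInfIndexEq_finiteIndex G hH.index_ne_zero
  have hK : ResiduallyP p K :=
    hr.of_injective hp (Subgroup.inclusion hKH) (Subgroup.inclusion_injective hKH)
  have hKc : K.Characteristic := Subgroup.iInfIndexEq_characteristic G H.index
  let L : Subgroup K := Subgroup.iInfIndexEq K p
  have hLfin : L.FiniteIndex := Subgroup.iInfIndexEq_finiteIndex K hp.ne_zero
  have hLc : L.Characteristic := Subgroup.iInfIndexEq_characteristic K p
  let θ : F →* MulAut K := (MulAut.characteristic K).comp ψ
  have hθ (w : F) (g : K) : ((θ w g : K) : G) = ψ w g := rfl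
  let ρ : F →* MulAut (K ⧸ L) := (MulAut.quotientCharacteristic L).comp θ
  let F' : Subgroup F := ρ.ker
  let θ' : F' →* MulAut K := θ.comp F'.subtype
  have hfin : F'.FiniteIndex := Subgroup.finiteIndex_ker ρ
  have hres : ResiduallyP p (K ⋊[θ'] F') := by
    refine hK.semidirectProduct hp
      (hF.of_injective hp F'.subtype F'.subtype_injective) θ' fun w M hM g => ?_
    have h1 : ρ w (g : K ⧸ L) = (g : K ⧸ L) := by
      rw [show ρ w = 1 from w.2]; rfl
    exact Subgroup.mem_iInfIndexEq.1 (QuotientGroup.eq.1 h1.symm) M hM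
  have hKψ (w : F) {g : G} (hg : g ∈ K) : ψ w g ∈ K := (θ w ⟨g, hg⟩).2
  let T : Subgroup (G ⋊[ψ] F) :=
    { carrier := {x | x.left ∈ K ∧ x.right ∈ F'}
      mul_mem' := fun hx hy => ⟨K.mul_mem hx.1 (hKψ _ hy.1), F'.mul_mem hx.2 hy.2⟩
      one_mem' := ⟨K.one_mem, F'.one_mem⟩
      inv_mem' := fun hx => ⟨hKψ _ (K.inv_mem hx.1), F'.inv_mem hx.2⟩ }
  refine ⟨T, ?_, ?_⟩
  · let c : (G ⋊[ψ] F) ⧸ T → (G ⧸ K) × (F ⧸ F') :=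
      fun x => ((x.out.left : G ⧸ K), (x.out.right : F ⧸ F'))
    have hc : Function.Injective c := by
      intro x y hxy
      rw [← x.out_eq', ← y.out_eq']
      refine QuotientGroup.eq.2 ⟨?_, QuotientGroup.eq.1 (congrArg Prod.snd hxy)⟩
      have := hKψ x.out.right⁻¹ (QuotientGroup.eq.1 (congrArg Prod.fst hxy))
      simpa using this
    have := Finite.of_injective c hc
    exact Subgroup.finiteIndex_of_finite_quotient
  · let j : T →* K ⋊[θ'] F' :=
      { toFun := fun x => ⟨⟨x.1.left, x.2.1⟩, ⟨x.1.right, x.2.2⟩⟩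
        map_one' := rfl
        map_mul' := fun _ _ => rfl }
    refine hres.of_injective hp j fun x y hxy => Subtype.ext (SemidirectProduct.ext ?_ ?_)
    · exact congrArg (fun z : K ⋊[θ'] F' => (z.left : G)) hxy
    · exact congrArg (fun z : K ⋊[θ'] F' => (z.right : F)) hxy

/-! ### Free groups are residually `p` -/

section WordRepresentation

variable {ι R : Type*} [CommRing R] {n : ℕ}

open Classical in
/-- The nilpotent operator attached to the letter `i` and a labelling of `0, 1, 2, …` by (at most)
one letter each: it maps the basis vector `e_(j+1)` to `e_j` if `j` has label `i`, and to `0`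
otherwise. In coordinates, `(letterShift i f) j` is `f (j + 1)` or `0`. -/
noncomputable def letterShift (R : Type*) [CommRing R] (n : ℕ) (lab : ℕ → Option ι) (i : ι) :
    Module.End R (Fin n → R) where
  toFun f j := if h : j.1 + 1 < n then (if lab j = some i then f ⟨j + 1, h⟩ else 0) else 0
  map_add' f g := by
    ext j
    by_cases h : j.1 + 1 < n <;> by_cases h' : lab j = some i <;> simp [h, h']
  map_smul' c f := by
    ext j
    by_cases h : j.1 + 1 < n <;> by_cases h' : lab j = some i <;> simp [h, h']

open Classical in
theorem letterShift_apply (lab : ℕ → Option ι) (i : ι) (f : Fin n → R) (j : Fin n) :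
    letterShift R n lab i f j =
      if h : j.1 + 1 < n then (if lab j = some i then f ⟨j + 1, h⟩ else 0) else 0 := rfl

/-- If no two neighbours carry the same label, the operators square to zero. -/
theorem letterShift_mul_self {lab : ℕ → Option ι}
    (hlab : ∀ (j : ℕ) (i : ι), lab j = some i → lab (j + 1) ≠ some i) (i : ι) :
    letterShift R n lab i * letterShift R n lab i = 0 := by
  refine LinearMap.ext fun f => funext fun j => ?_
  rw [Module.End.mul_apply, letterShift_apply]
  split_ifs with h h'
  · rw [letterShift_apply]
    simp [hlab _ _ h']
  all_goals rfl

/-- The vectors supported on the first `d` coordinates. -/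
def initialVectors (R : Type*) [CommRing R] (n d : ℕ) : Submodule R (Fin n → R) where
  carrier := {f | ∀ j : Fin n, d ≤ j → f j = 0}
  add_mem' hf hg j hj := by simp [hf j hj, hg j hj]
  zero_mem' _ _ := rfl
  smul_mem' c f hf j hj := by simp [hf j hj]

theorem initialVectors_mono {d e : ℕ} (h : d ≤ e) :
    initialVectors R n d ≤ initialVectors R n e :=
  fun _ hf j hj => hf j (h.trans hj)

/-- `x` is upper unitriangular: it acts trivially on the successive quotients of the flag
`initialVectors`. -/
def IsUnitriangular (x : Module.End R (Fin n → R)) : Prop :=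
  ∀ (d : ℕ), ∀ f ∈ initialVectors R n (d + 1), x f - f ∈ initialVectors R n d

theorem IsUnitriangular.one : IsUnitriangular (1 : Module.End R (Fin n → R)) := fun d f _ => by
  simp

theorem IsUnitriangular.mul {x y : Module.End R (Fin n → R)} (hx : IsUnitriangular x)
    (hy : IsUnitriangular y) : IsUnitriangular (x * y) := by
  intro d f hf
  have h1 := hy d f hf
  have h2 : y f ∈ initialVectors R n (d + 1) := by
    simpa using add_mem (initialVectors_mono d.le_succ h1) hf
  rw [Module.End.mul_apply, ← sub_add_sub_cancel _ (y f)]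
  exact add_mem (hx d _ h2) h1

theorem IsUnitriangular.pow {x : Module.End R (Fin n → R)} (hx : IsUnitriangular x) :
    ∀ k : ℕ, IsUnitriangular (x ^ k)
  | 0 => by simpa using IsUnitriangular.one
  | k + 1 => by simpa [pow_succ] using (hx.pow k).mul hx

theorem IsUnitriangular.one_add_smul_letterShift (lab : ℕ → Option ι) (i : ι) (a : R) :
    IsUnitriangular (1 + a • letterShift R n lab i) := by
  intro d f hf j hj
  simp only [LinearMap.add_apply, Module.End.one_apply, LinearMap.smul_apply, add_sub_cancel_left,
    Pi.smul_apply, letterShift_apply]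
  split_ifs with h h'
  · rw [hf _ (Nat.succ_le_succ hj), smul_zero]
  all_goals exact smul_zero _

/-- Over a ring of characteristic `c`, a unitriangular operator has order dividing `c ^ n`. -/
theorem IsUnitriangular.pow_pow_eq_one {x : Module.End R (Fin n → R)} (hx : IsUnitriangular x)
    {c : ℕ} (hc : (c : R) = 0) : x ^ c ^ n = 1 := by
  have key (d : ℕ) : ∀ f ∈ initialVectors R n d, (x ^ c ^ d) f = f := by
    induction d with
    | zero =>
      intro f hf
      have : f = 0 := funext fun j => hf j (Nat.zero_le _)
      rw [this, map_zero]
    | succ d ih =>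
      intro f hf
      set y := x ^ c ^ d
      -- On this step of the flag `y = 1 + u` with `u ^ 2 = 0`, so that `y ^ m = 1 + m u`.
      have hu := hx.pow (c ^ d) d f hf
      have hpow (m : ℕ) : (y ^ m) f = f + (m : R) • (y f - f) := by
        induction m with
        | zero => simp
        | succ m ihm =>
          rw [pow_succ', Module.End.mul_apply, ihm, map_add, map_smul, ih _ hu]
          push_cast
          module
      rw [pow_succ, pow_mul, hpow c, hc, zero_smul, add_zero]
  exact LinearMap.ext fun f => key n f fun j hj => absurd j.2 hj.not_gt

/-- The operators `1 + a N` with `N = letterShift R n lab i` form a cyclic group, as `N ^ 2 = 0`. -/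
noncomputable def letterHom (R : Type*) [CommRing R] (n : ℕ) {lab : ℕ → Option ι}
    (hlab : ∀ (j : ℕ) (i : ι), lab j = some i → lab (j + 1) ≠ some i) (i : ι) :
    Multiplicative ℤ →* Module.End R (Fin n → R) where
  toFun a := 1 + ((a.toAdd : ℤ) : R) • letterShift R n lab i
  map_one' := by simp
  map_mul' a b := by
    have h := letterShift_mul_self (R := R) (n := n) hlab i
    simp only [toAdd_mul, Int.cast_add, add_mul, mul_add, one_mul, mul_one, smul_mul_assoc,
      mul_smul_comm, h, smul_zero, add_zero, add_smul]
    abel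

/-- If the letters of a word label the positions `t, t + 1, …, n - 2`, then the word sends the last
basis vector to a vector whose coordinates before `t` vanish and whose `t`-th one is the product of the
exponents: the only path from `n - 1` down to `t` uses every syllable of the word once. -/
theorem prod_letterShift_apply (lab : ℕ → Option ι) (l : List (ι × R)) :
    ∀ t : ℕ, (ht : t + l.length + 1 = n) →
      (∀ (s : ℕ) (hs : s < l.length), lab (t + s) = some l[s].1) →
      ∀ j : Fin n, j.1 ≤ t →
        (l.map fun x => (1 + x.2 • letterShift R n lab x.1 : Module.End R (Fin n → R))).prod
          (fun j => if j.1 + 1 = n then 1 else 0) j =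
        if j.1 = t then (l.map Prod.snd).prod else 0 := by
  induction l with
  | nil =>
    intro t ht _ j hj
    simp only [List.length_nil, add_zero] at ht
    simp only [List.map_nil, List.prod_nil, Module.End.one_apply]
    congr 1
    simp only [eq_iff_iff]
    omega
  | cons x l ih =>
    intro t ht hl j hj
    rw [List.length_cons] at ht
    have h0 : lab t = some x.1 := hl 0 (by simp)
    have ih' := ih (t + 1) (by omega) fun s hs => by
      have := hl (s + 1) (by simpa using hs)
      rw [List.getElem_cons_succ] at this
      rwa [show t + 1 + s = t + (s + 1) by omega]
    rw [List.map_cons, List.prod_cons, Module.End.mul_apply, LinearMap.add_apply,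
      Module.End.one_apply, LinearMap.smul_apply, Pi.add_apply, Pi.smul_apply, letterShift_apply,
      ih' j (by omega), if_neg (by omega), zero_add, dif_pos (by omega),
      ih' ⟨j + 1, by omega⟩ (by simpa using hj)]
    by_cases hjt : j.1 = t
    · simp [hjt, h0]
    · simp [hjt]

end WordRepresentation

/-- The exponent of an element of the free group on one generator. -/
def FreeGroup.unitExponent : FreeGroup Unit →* Multiplicative ℤ :=
  FreeGroup.lift fun _ => Multiplicative.ofAdd 1

theorem FreeGroup.unitExponent_ne_zero {x : FreeGroup Unit} (hx : x ≠ 1) :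
    (FreeGroup.unitExponent x).toAdd ≠ 0 := by
  obtain ⟨k, rfl⟩ : ∃ k : ℤ, FreeGroup.of () ^ k = x :=
    ⟨_, FreeGroup.freeGroupUnitEquivInt.symm_apply_apply x⟩
  intro h
  have hk : k = 0 := by simpa [FreeGroup.unitExponent] using h
  exact hx (by rw [hk, zpow_zero])

open Monoid in
theorem residuallyP_coprodI_freeGroup_unit {p : ℕ} (hp : p.Prime) (ι : Type*) :
    ResiduallyP p (CoprodI fun _ : ι => FreeGroup Unit) := by
  classical
  intro g hg
  let w : CoprodI.Word fun _ : ι => FreeGroup Unit := CoprodI.Word.equiv g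
  have hw : w.prod = g := CoprodI.Word.equiv.symm_apply_apply g
  have hlen : 0 < w.toList.length := by
    refine List.length_pos_of_ne_nil fun h => hg ?_
    rw [← hw, CoprodI.Word.prod, h]
    rfl
  let lab : ℕ → Option ι := fun j => w.toList[j]?.map Sigma.fst
  have hlab (j : ℕ) (i : ι) (hj : lab j = some i) : lab (j + 1) ≠ some i := by
    intro hj'
    simp only [lab, Option.map_eq_some_iff, List.getElem?_eq_some_iff] at hj hj'
    obtain ⟨x, ⟨h1, rfl⟩, hx⟩ := hj
    obtain ⟨y, ⟨h2, rfl⟩, hy⟩ := hj'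
    exact List.isChain_iff_getElem.1 w.chain_ne j h2 (hx.trans hy.symm)
  let a : ℤ := (w.toList.map fun x => (FreeGroup.unitExponent x.2).toAdd).prod
  have ha : a ≠ 0 := by
    refine List.prod_ne_zero fun h => ?_
    obtain ⟨x, hx, h0⟩ := List.mem_map.1 h
    exact FreeGroup.unitExponent_ne_zero (w.ne_one x hx) h0
  -- Any `m` with `p ^ m > |a|` would do.
  let m : ℕ := a.natAbs
  let R := ZMod (p ^ m)
  have : NeZero (p ^ m) := ⟨pow_ne_zero _ hp.ne_zero⟩
  have haR : (a : R) ≠ 0 := by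
    intro h
    have h1 := Int.natAbs_dvd_natAbs.2 ((ZMod.intCast_zmod_eq_zero_iff_dvd a (p ^ m)).1 h)
    rw [Int.natAbs_natCast] at h1
    exact (Nat.le_of_dvd (Int.natAbs_pos.2 ha) h1).not_gt (Nat.lt_pow_self hp.one_lt)
  let n := w.toList.length + 1
  let Φ : CoprodI (fun _ : ι => FreeGroup Unit) →* Module.End R (Fin n → R) :=
    CoprodI.lift fun i => (letterHom R n hlab i).comp FreeGroup.unitExponent
  have hΦ (x) : IsUnitriangular (Φ x) := by
    induction x using CoprodI.induction_on with
    | one => rw [map_one]; exact IsUnitriangular.one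
    | of i y =>
      rw [CoprodI.lift_of]
      exact IsUnitriangular.one_add_smul_letterShift _ _ _
    | mul x y hx hy => rw [map_mul]; exact hx.mul hy
  have : Finite (Module.End R (Fin n → R)) := Finite.of_injective _ DFunLike.coe_injective
  have hrange : IsPGroup p Φ.toHomUnits.range := by
    rintro ⟨_, x, rfl⟩
    refine ⟨m * n, Subtype.ext (Units.ext ?_)⟩
    rw [pow_mul]
    exact (hΦ x).pow_pow_eq_one (ZMod.natCast_self _)
  refine ⟨Φ.toHomUnits.ker, inferInstance,
    Φ.toHomUnits.exists_index_ker_eq_prime_pow hp hrange, fun hker => ?_⟩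
  have h1 : Φ g = 1 := congrArg Units.val (MonoidHom.mem_ker.1 hker)
  let l : List (ι × R) :=
    w.toList.map fun x => (x.1, (((FreeGroup.unitExponent x.2).toAdd : ℤ) : R))
  have hprod : Φ g =
      (l.map fun x => (1 + x.2 • letterShift R n lab x.1 : Module.End R (Fin n → R))).prod := by
    rw [← hw, CoprodI.Word.prod, map_list_prod, List.map_map, List.map_map]
    congr 1
  have hl : (l.map Prod.snd).prod = (a : R) := by
    change _ = Int.castRingHom R (List.prod _)
    rw [map_list_prod, List.map_map, List.map_map]
    rfl
  have key := prod_letterShift_apply (n := n) lab l 0 (by simp [l, n])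
    (fun s hs => by
      have hs' : s < w.toList.length := by simpa [l] using hs
      simp [lab, l, hs']) ⟨0, Nat.succ_pos _⟩ le_rfl
  rw [← hprod, h1, hl, Module.End.one_apply, if_pos rfl, if_neg (by simp only [n]; omega)] at key
  exact haR key.symm

/-- Free groups are residually `p`: a reduced word `x₁ ^ a₁ ⋯ x_k ^ a_k` acts nontrivially on
`(ℤ / p ^ m) ^ (k + 1)` through a unitriangular representation, one of its matrix entries being
`a₁ ⋯ a_k`. -/
theorem residuallyP_freeGroup {p : ℕ} (hp : p.Prime) (ι : Type*) :
    ResiduallyP p (FreeGroup ι) :=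
  (residuallyP_coprodI_freeGroup_unit hp ι).of_injective hp freeGroupEquivCoprodI.toMonoidHom
    freeGroupEquivCoprodI.injective

/-! ### Mapping tori -/

section MappingTorus

variable {G ι : Type*} [Group G] (φ : ι → (G ≃* G))

/-- The action of the free group on the letters `tᵢ` on `G` in which `tᵢ` acts as `φᵢ`. -/
def torusAction : FreeGroup ι →* MulAut G := FreeGroup.lift φ

/-- The natural map from the mapping torus to the semidirect product. -/
def MappingTorus.toSemidirect :
    MappingTorus (fun i => (φ i).toMonoidHom) →* G ⋊[torusAction φ] FreeGroup ι :=
  QuotientGroup.lift _ (Monoid.Coprod.lift SemidirectProduct.inl SemidirectProduct.inr) (by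
    refine Subgroup.normalClosure_le_normal (N := MonoidHom.ker _) ?_
    rintro _ ⟨i, g, rfl⟩
    have h := SemidirectProduct.inl_aut (φ := torusAction φ) (FreeGroup.of i) g
    rw [torusAction, FreeGroup.lift_apply_of] at h
    simp only [SetLike.mem_coe, MonoidHom.mem_ker, map_mul, map_inv, Monoid.Coprod.lift_apply_inl,
      Monoid.Coprod.lift_apply_inr]
    rw [mul_inv_eq_one, ← map_inv]
    exact h.symm)

theorem MappingTorus.mk_inl_torusAction (w : FreeGroup ι) (g : G) :
    (QuotientGroup.mk (Monoid.Coprod.inl (torusAction φ w g)) :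
      MappingTorus (fun i => (φ i).toMonoidHom)) =
    QuotientGroup.mk (Monoid.Coprod.inr w) * QuotientGroup.mk (Monoid.Coprod.inl g) *
      (QuotientGroup.mk (Monoid.Coprod.inr w))⁻¹ := by
  have hof (i : ι) (g : G) : (QuotientGroup.mk (Monoid.Coprod.inl (φ i g)) :
      MappingTorus (fun i => (φ i).toMonoidHom)) =
      QuotientGroup.mk (Monoid.Coprod.inr (FreeGroup.of i)) *
        QuotientGroup.mk (Monoid.Coprod.inl g) *
        (QuotientGroup.mk (Monoid.Coprod.inr (FreeGroup.of i)))⁻¹ := by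
    refine (mul_inv_eq_one.1 ?_).symm
    exact (QuotientGroup.eq_one_iff _).2 (Subgroup.subset_normalClosure ⟨i, g, rfl⟩)
  induction w using FreeGroup.induction_on generalizing g with
  | C1 =>
    rw [map_one, map_one, MulAut.one_apply, QuotientGroup.mk_one]
    group
  | of i => simpa [torusAction] using hof i g
  | inv_of i _ =>
    have h := hof i ((φ i).symm g)
    rw [MulEquiv.apply_symm_apply] at h
    have h1 : torusAction φ (FreeGroup.of i)⁻¹ g = (φ i).symm g := by
      rw [map_inv, torusAction, FreeGroup.lift_apply_of]; rfl
    rw [h1, h, map_inv, QuotientGroup.mk_inv]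
    group
  | mul x y hx hy =>
    rw [map_mul, MulAut.mul_apply, hx, hy, map_mul, QuotientGroup.mk_mul]
    group

theorem MappingTorus.toSemidirect_injective :
    Function.Injective (MappingTorus.toSemidirect φ) := by
  let q := QuotientGroup.mk' (Subgroup.normalClosure
    (mappingTorusRelators fun i => (φ i).toMonoidHom))
  let Θ : G ⋊[torusAction φ] FreeGroup ι →* MappingTorus (fun i => (φ i).toMonoidHom) :=
    SemidirectProduct.lift (q.comp Monoid.Coprod.inl) (q.comp Monoid.Coprod.inr) fun w =>
      MonoidHom.ext fun g => MappingTorus.mk_inl_torusAction φ w g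
  have h : Θ.comp (MappingTorus.toSemidirect φ) = MonoidHom.id _ := by
    refine QuotientGroup.monoidHom_ext _ (Monoid.Coprod.hom_ext ?_ ?_)
    · refine MonoidHom.ext fun g => ?_
      change Θ (Monoid.Coprod.lift _ _ (Monoid.Coprod.inl g)) = q (Monoid.Coprod.inl g)
      rw [Monoid.Coprod.lift_apply_inl, SemidirectProduct.lift_inl]
      rfl
    · refine MonoidHom.ext fun w => ?_
      change Θ (Monoid.Coprod.lift _ _ (Monoid.Coprod.inr w)) = q (Monoid.Coprod.inr w)
      rw [Monoid.Coprod.lift_apply_inr, SemidirectProduct.lift_inr]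
      rfl
  exact Function.LeftInverse.injective (g := Θ) fun x => DFunLike.congr_fun h x

end MappingTorus

/-! ### Graphs of groups with bijective edge maps -/

namespace GraphOfGroups

variable {V E : Type*} {Y : SerreGraph V E} (𝒢 : GraphOfGroups Y)

theorem edgeCast_edgeCast {a b c : Y.TopEdge} (h : a = b) (h' : b = c) (g : 𝒢.edgeGroup a) :
    𝒢.edgeCast h' (𝒢.edgeCast h g) = 𝒢.edgeCast (h.trans h') g := by
  subst h h'
  rfl

theorem edgeMapBar_apply (e : E) (g : 𝒢.edgeGroup (Y.topEdge e)) :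
    𝒢.edgeMapBar e g = 𝒢.edgeMap (Y.bar e) (𝒢.edgeCast (Y.topEdge_bar e) g) := rfl

theorem edgeMapBar_bijective (h : ∀ e, Function.Bijective (𝒢.edgeMap e)) (e : E) :
    Function.Bijective (𝒢.edgeMapBar e) :=
  (h (Y.bar e)).comp (𝒢.edgeCast (Y.topEdge_bar e)).bijective

/-- The isomorphism from `G_{t e}` to `G_{o e} = G_{t (bar e)}` given by the edge `e`. -/
noncomputable def edgeEquiv (h : ∀ e, Function.Bijective (𝒢.edgeMap e)) (e : E) :
    𝒢.vertexGroup (Y.t e) ≃* 𝒢.vertexGroup (Y.t (Y.bar e)) :=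
  (MulEquiv.ofBijective _ (h e)).symm.trans
    (MulEquiv.ofBijective _ (𝒢.edgeMapBar_bijective h e))

theorem edgeEquiv_edgeMap (h : ∀ e, Function.Bijective (𝒢.edgeMap e)) (e : E)
    (g : 𝒢.edgeGroup (Y.topEdge e)) :
    𝒢.edgeEquiv h e (𝒢.edgeMap e g) = 𝒢.edgeMapBar e g := by
  have : (MulEquiv.ofBijective _ (h e)).symm (𝒢.edgeMap e g) = g :=
    (MulEquiv.ofBijective _ (h e)).symm_apply_apply g
  rw [edgeEquiv, MulEquiv.trans_apply, this]
  rfl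

theorem ofEdge_mul_ofVertex (h : ∀ e, Function.Bijective (𝒢.edgeMap e)) (e : E)
    (x : 𝒢.vertexGroup (Y.t e)) :
    𝒢.ofEdge e * 𝒢.ofVertex _ x = 𝒢.ofVertex _ (𝒢.edgeEquiv h e x) * 𝒢.ofEdge e := by
  obtain ⟨g, rfl⟩ := (h e).2 x
  have h1 : 𝒢.ofEdge e * 𝒢.ofVertex _ (𝒢.edgeMap e g) * 𝒢.ofEdge (Y.bar e) *
      (𝒢.ofVertex _ (𝒢.edgeMapBar e g))⁻¹ = 1 :=
    (QuotientGroup.eq_one_iff _).2 (Subgroup.subset_normalClosure ⟨e, g, rfl⟩)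
  rw [edgeEquiv_edgeMap, ← mul_inv_eq_one.1 h1, ← inv_ofEdge, inv_mul_cancel_right]

/-- In a connected graph of groups with bijective edge maps all vertex groups are isomorphic. -/
theorem nonempty_vertexGroup_equiv (hY : Y.Connected) (h : ∀ e, Function.Bijective (𝒢.edgeMap e))
    (v₀ v : V) : Nonempty (𝒢.vertexGroup v ≃* 𝒢.vertexGroup v₀) := by
  induction hY v₀ v with
  | refl => exact ⟨MulEquiv.refl _⟩
  | tail _ hbc ih =>
    obtain ⟨e, rfl, rfl⟩ := hbc
    rw [Y.o_eq_t_bar] at ih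
    obtain ⟨i⟩ := ih
    exact ⟨(𝒢.edgeEquiv h e).trans i⟩

section Semidirect

variable (h : ∀ e, Function.Bijective (𝒢.edgeMap e)) {G : Type*} [Group G]
  (τ : ∀ v, 𝒢.vertexGroup v ≃* G)

/-- The automorphism of `G` given by the edge `e`, once all vertex groups are identified
with `G`. -/
noncomputable def edgeAut (e : E) : MulAut G :=
  ((τ (Y.t e)).symm.trans (𝒢.edgeEquiv h e)).trans (τ (Y.t (Y.bar e)))

theorem edgeAut_apply (e : E) (x : 𝒢.vertexGroup (Y.t e)) :
    𝒢.edgeAut h τ e (τ _ x) = τ _ (𝒢.edgeEquiv h e x) := by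
  simp [edgeAut]

theorem edgeAut_bar (e : E) : 𝒢.edgeAut h τ (Y.bar e) = (𝒢.edgeAut h τ e)⁻¹ := by
  rw [eq_inv_iff_mul_eq_one]
  ext y
  obtain ⟨x, rfl⟩ := (τ (Y.t e)).surjective y
  obtain ⟨g, rfl⟩ := (h e).2 x
  have key (e' : E) (he : e = e') (hc : Y.topEdge e = Y.topEdge e') :
      τ _ (𝒢.edgeMap e' (𝒢.edgeCast hc g)) = τ _ (𝒢.edgeMap e g) := by
    subst he
    rfl
  rw [MulAut.mul_apply, edgeAut_apply, edgeEquiv_edgeMap, edgeMapBar_apply, edgeAut_apply,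
    edgeEquiv_edgeMap, edgeMapBar_apply, edgeCast_edgeCast, key _ (Y.bar_bar e).symm]
  rfl

open Classical in
variable (Y) in
/-- The edge `e` as an element of a free group in which `bar e = e⁻¹`. An orientation of `Y` is
chosen with the help of a well-ordering of `E`: the positive edges are those with `e < bar e`.
(The generators of `FreeGroup E` belonging to the other edges play no role.) -/
noncomputable def orientedEdge (e : E) : FreeGroup E :=
  if WellOrderingRel e (Y.bar e) then FreeGroup.of e else (FreeGroup.of (Y.bar e))⁻¹

theorem orientedEdge_mul_orientedEdge_bar (e : E) :
    orientedEdge Y e * orientedEdge Y (Y.bar e) = 1 := by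
  rcases trichotomous_of WellOrderingRel e (Y.bar e) with he | he | he
  · rw [orientedEdge, orientedEdge, Y.bar_bar, if_pos he, if_neg (asymm he), mul_inv_cancel]
  · exact absurd he.symm (Y.bar_ne e)
  · rw [orientedEdge, orientedEdge, Y.bar_bar, if_pos he, if_neg (asymm he), inv_mul_cancel]

/-- A map on the oriented edges which is compatible with inversion is determined on all edges. -/
theorem lift_orientedEdge {H : Type*} [Group H] (f : E → H) (hf : ∀ e, f (Y.bar e) = (f e)⁻¹)
    (e : E) : FreeGroup.lift f (orientedEdge Y e) = f e := by
  rw [orientedEdge]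
  split_ifs
  · rw [FreeGroup.lift_apply_of]
  · rw [map_inv, FreeGroup.lift_apply_of, hf, inv_inv]

/-- The action of the free group on `G` in which each edge acts as `edgeAut`. -/
noncomputable def edgeAction : FreeGroup E →* MulAut G := FreeGroup.lift (𝒢.edgeAut h τ)

/-- The morphism from the path group to the semidirect product which identifies all vertex groups
with `G`. -/
noncomputable def toSemidirect : 𝒢.PathGroup →* G ⋊[𝒢.edgeAction h τ] FreeGroup E :=
  QuotientGroup.lift _ (Monoid.Coprod.lift
    (Monoid.CoprodI.lift fun v => SemidirectProduct.inl.comp (τ v).toMonoidHom)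
    (FreeGroup.lift fun e => SemidirectProduct.inr (orientedEdge Y e))) (by
    refine Subgroup.normalClosure_le_normal (N := MonoidHom.ker _) ?_
    rintro _ ⟨e, g, rfl⟩
    have h1 := SemidirectProduct.inl_aut (φ := 𝒢.edgeAction h τ) (orientedEdge Y e)
      (τ _ (𝒢.edgeMap e g))
    rw [edgeAction, lift_orientedEdge _ (𝒢.edgeAut_bar h τ), edgeAut_apply,
      edgeEquiv_edgeMap] at h1
    simp only [SetLike.mem_coe, MonoidHom.mem_ker, map_mul, map_inv, preEdge, preVertex,
      MonoidHom.comp_apply, Monoid.Coprod.lift_apply_inl, Monoid.Coprod.lift_apply_inr,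
      FreeGroup.lift_apply_of, Monoid.CoprodI.lift_of]
    rw [mul_inv_eq_one, eq_inv_of_mul_eq_one_right (orientedEdge_mul_orientedEdge_bar e)]
    exact h1.symm)

theorem toSemidirect_ofVertex (v : V) (g : 𝒢.vertexGroup v) :
    𝒢.toSemidirect h τ (𝒢.ofVertex v g) = SemidirectProduct.inl (τ v g) := by
  simp [toSemidirect, ofVertex, preVertex]

theorem toSemidirect_ofEdge (e : E) :
    𝒢.toSemidirect h τ (𝒢.ofEdge e) = SemidirectProduct.inr (orientedEdge Y e) := by
  simp [toSemidirect, ofEdge, preEdge]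

/-- The vertex group elements in a path can be moved to its start, where they combine to a single
element `g`; what remains is a word `q` in the oriented edges. -/
theorem Represented.exists_eq_ofVertex_mul {v w : V} {x : 𝒢.PathGroup}
    (hx : 𝒢.Represented v w x) :
    ∃ (g : 𝒢.vertexGroup v) (q : FreeGroup E),
      x = 𝒢.ofVertex v g * FreeGroup.lift 𝒢.ofEdge q ∧
      𝒢.toSemidirect h τ (FreeGroup.lift 𝒢.ofEdge q) = SemidirectProduct.inr q ∧
      ∀ y : 𝒢.vertexGroup w, ∃ z : 𝒢.vertexGroup v,
        FreeGroup.lift 𝒢.ofEdge q * 𝒢.ofVertex w y =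
          𝒢.ofVertex v z * FreeGroup.lift 𝒢.ofEdge q := by
  induction hx with
  | start g => exact ⟨g, 1, by simp, by simp, fun y => ⟨y, by simp⟩⟩
  | step e a _ ih =>
    obtain ⟨g, q, rfl, hq, hmove⟩ := ih
    have hs : FreeGroup.lift 𝒢.ofEdge (q * orientedEdge Y e) =
        FreeGroup.lift 𝒢.ofEdge q * 𝒢.ofEdge e := by
      rw [map_mul, lift_orientedEdge _ fun e => (𝒢.inv_ofEdge e).symm]
    have hmove' (y : 𝒢.vertexGroup (Y.t e)) : ∃ z : 𝒢.vertexGroup v,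
        FreeGroup.lift 𝒢.ofEdge q * 𝒢.ofEdge e * 𝒢.ofVertex _ y =
          𝒢.ofVertex v z * (FreeGroup.lift 𝒢.ofEdge q * 𝒢.ofEdge e) := by
      rw [Y.o_eq_t_bar] at hmove
      obtain ⟨z, hz⟩ := hmove (𝒢.edgeEquiv h e y)
      exact ⟨z, by rw [mul_assoc, ofEdge_mul_ofVertex 𝒢 h, ← mul_assoc, hz, mul_assoc]⟩
    obtain ⟨z, hz⟩ := hmove' a
    refine ⟨g * z, q * orientedEdge Y e, ?_, ?_, ?_⟩
    · rw [hs, map_mul, mul_assoc, mul_assoc, ← mul_assoc (FreeGroup.lift _ _), hz, mul_assoc]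
    · rw [hs, map_mul, hq, toSemidirect_ofEdge, ← map_mul]
    · rwa [hs]

/-- The fundamental group embeds in the semidirect product, although the path group need not. -/
theorem toSemidirect_comp_subtype_injective (v₀ : V) :
    Function.Injective ((𝒢.toSemidirect h τ).comp (𝒢.fundamentalGroup v₀).subtype) := by
  rw [injective_iff_map_eq_one]
  rintro ⟨x, hx⟩ hx1
  obtain ⟨g, q, rfl, hq, -⟩ := Represented.exists_eq_ofVertex_mul 𝒢 h τ hx
  replace hx1 : 𝒢.toSemidirect h τ (𝒢.ofVertex v₀ g * FreeGroup.lift 𝒢.ofEdge q) = 1 := hx1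
  rw [map_mul, toSemidirect_ofVertex, hq, ← SemidirectProduct.mk_eq_inl_mul_inr] at hx1
  have hg : g = 1 := (τ v₀).map_eq_one_iff.1 (congrArg SemidirectProduct.left hx1)
  have hq1 : q = 1 := congrArg SemidirectProduct.right hx1
  exact Subtype.ext (by simp [hg, hq1])

end Semidirect

end GraphOfGroups

theorem mainTheorem12 (p : ℕ) (hp : p.Prime) :
    (∀ (V : Type*) (E : Type*) [Finite V] [Finite E] (Y : SerreGraph V E), Y.Connected →
      ∀ 𝒢 : GraphOfGroups Y,
        (∀ v, Group.FG (𝒢.vertexGroup v)) →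
        (∀ v, VirtuallyResiduallyP p (𝒢.vertexGroup v)) →
        (∀ e, Function.Bijective (𝒢.edgeMap e)) →
        ∀ v₀ : V, VirtuallyResiduallyP p (𝒢.fundamentalGroup v₀)) ∧
    (∀ (G : Type*) [Group G], Group.FG G → VirtuallyResiduallyP p G →
      ∀ (r : ℕ) (φ : Fin r → (G ≃* G)),
        VirtuallyResiduallyP p (MappingTorus (fun i => (φ i).toMonoidHom))) := by
  refine ⟨fun V E _ _ Y hY 𝒢 hfg hvr hbij v₀ => ?_, fun G _ hfg hvr r φ => ?_⟩
  · let τ := fun v => (𝒢.nonempty_vertexGroup_equiv hY hbij v₀ v).some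
    have := hfg v₀
    exact ((hvr v₀).semidirectProduct hp (residuallyP_freeGroup hp E) _).of_injective hp _
      (𝒢.toSemidirect_comp_subtype_injective hbij τ v₀)
  · exact (hvr.semidirectProduct hp (residuallyP_freeGroup hp (Fin r)) _).of_injective hp _
      (MappingTorus.toSemidirect_injective φ)
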